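/- Let $n\ge 1$. Let $C(S^{n-1}_{\mathbb R,*})$ be the universal unital $C^*$-algebra generated by $v_1,\dots,v_n$ subject to the relations $v_i^*=v_i$, $\sum_{i=1}^n v_i^2=1$ and $v_iv_jv_k=v_kv_jv_i$ for all $1\le i,j,k\le n$. Let $\nu$ be its sign automorphism, $\nu(v_i)=-v_i$, and put $C(S^{n-1}_{\mathbb R,*})_0=\{a\mid \nu(a)=a\}$ and $C(S^{n-1}_{\mathbb R,*})_1=\{a\mid\nu(a)=-a\}$. Quantum subspaces $X\subset S^{n-1}_{\mathbb R,*}$ correspond to the quotient $C^*$-algebras $C(X)=C(S^{n-1}_{\mathbb R,*})/I$, i.e. to the closed two-sided ideals $I$ of $C(S^{n-1}_{\mathbb R,*})$ (the zero quotient, i.e. the empty subspace, is allowed); $X$ is called symmetric if $I$ is $\mathbb Z_2$-graded, i.e. $I=(I\cap C(S^{n-1}_{\mathbb R,*})_0)\oplus(I\cap C(S^{n-1}_{\mathbb R,*})_1)$. Let $P^{n-1}_{\mathbb C}=S^{n-1}_{\mathbb C}/\mathbb T$ be the orbit space of the unit sphere of $\mathbb C^n$ under multiplication by complex numbers of modulus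 $1$, let $z_iz_j^*\in C(P^{n-1}_{\mathbb C})$ be the functions induced by $z\mapsto z_i\overline{z_j}$, and let complex conjugation act on $P^{n-1}_{\mathbb C}$ coordinatewise. Then there is a unique $*$-algebra isomorphism $\Phi: C(P^{n-1}_{\mathbb C})\to C(S^{n-1}_{\mathbb R,*})_0$ such that $\Phi(z_iz_j^*)=v_iv_j$ for all $i,j$, and there is a bijection $$\{\text{conjugation-stable closed subspaces } Y\subset P^{n-1}_{\mathbb C}\}\longleftrightarrow\{\text{symmetric quantum subspaces } X\subset S^{n-1}_{\mathbb R,*}\},$$ which sends $Y$ to the quantum subspace $X$ defined by $C(X)=C(S^{n-1}_{\mathbb R,*})/\langle\Phi(\mathcal J_Y)\rangle$, where $\mathcal J_Y\subset C(P^{n-1}_{\mathbb C})$ is the ideal of functions vanishing on $Y$ and $\langle\Phi(\mathcal J_Y)\rangle$ is the two-sided ideal generated by $\Phi(\mathcal J_Y)$ (which is, in particular, closed). -/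

import Mathlib

noncomputable section

/-! ### C⋆-seminorms on a `*`-algebra and the C⋆-algebras they define -/

/-- A C⋆-seminorm on a unital complex `*`-algebra: a submultiplicative seminorm satisfying the
C⋆-identity. -/
structure CStarSeminorm (F : Type*) [Ring F] [StarRing F] [Algebra ℂ F] extends
    Seminorm ℂ F where
  mul_le' : ∀ x y : F, toFun (x * y) ≤ toFun x * toFun y
  star_mul_self' : ∀ x : F, toFun (star x * x) = toFun x * toFun x

namespace CStarSeminorm

section Basic

variable {F : Type*} [Ring F] [StarRing F] [Algebra ℂ F]

instance : CoeFun (CStarSeminorm F) (fun _ => F → ℝ) := ⟨fun p => p.toSeminorm⟩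

theorem mul_le (p : CStarSeminorm F) (x y : F) : p (x * y) ≤ p x * p y := p.mul_le' x y

theorem star_mul_self (p : CStarSeminorm F) (x : F) : p (star x * x) = p x * p x :=
  p.star_mul_self' x

theorem nonneg (p : CStarSeminorm F) (x : F) : 0 ≤ p x := apply_nonneg p.toSeminorm x

theorem le_map_star (p : CStarSeminorm F) (x : F) : p x ≤ p (star x) := by
  have h := p.mul_le (star x) x
  rw [p.star_mul_self] at h
  rcases (p.nonneg x).eq_or_lt with h0 | h0
  · rw [← h0]; exact p.nonneg _
  · exact le_of_mul_le_mul_right h h0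

theorem map_star (p : CStarSeminorm F) (x : F) : p (star x) = p x :=
  le_antisymm (by simpa using p.le_map_star (star x)) (p.le_map_star x)

/-- The zero C⋆-seminorm (it corresponds to the zero C⋆-algebra). -/
def zero (F : Type*) [Ring F] [StarRing F] [Algebra ℂ F] : CStarSeminorm F where
  toSeminorm := 0
  mul_le' _ _ := by
    change (0 : ℝ) ≤ 0 * 0
    simp
  star_mul_self' _ := by
    change (0 : ℝ) = 0 * 0
    simp

end Basic

variable {F : Type*} [Ring F] [StarRing F] [Algebra ℂ F] [StarModule ℂ F]

/-- The `*`-algebra `F` equipped with the C⋆-seminorm `p`. -/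
def Carrier (_ : CStarSeminorm F) : Type _ := F

variable (p : CStarSeminorm F)

instance : Ring p.Carrier := inferInstanceAs (Ring F)
instance : StarRing p.Carrier := inferInstanceAs (StarRing F)
instance : Algebra ℂ p.Carrier := inferInstanceAs (Algebra ℂ F)
instance : StarModule ℂ p.Carrier := inferInstanceAs (StarModule ℂ F)

instance : SeminormedRing p.Carrier where
  __ := (inferInstance : Ring p.Carrier)
  __ := p.toSeminorm.toAddGroupSeminorm.toSeminormedAddCommGroup
  norm_mul_le := p.mul_le

instance : NormedAlgebra ℂ p.Carrier where
  norm_smul_le c x := (map_smul_eq_mul p.toSeminorm c (show F from x)).le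

instance : NormedStarGroup p.Carrier where
  norm_star_le x := (p.map_star (show F from x)).le

/-- The C⋆-algebra defined by a C⋆-seminorm: the separated completion of `F`. -/
abbrev Envelope : Type _ := UniformSpace.Completion p.Carrier


theorem uniformContinuous_star : UniformContinuous (star : p.Carrier → p.Carrier) :=
  (starₗᵢ ℂ : p.Carrier ≃ₗᵢ⋆[ℂ] p.Carrier).isometry.uniformContinuous

instance : StarRing p.Envelope where
  star := UniformSpace.Completion.map star
  star_involutive x := by
    have hc : Continuous (UniformSpace.Completion.map (star : p.Carrier → p.Carrier)) :=
      UniformSpace.Completion.continuous_map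
    refine UniformSpace.Completion.induction_on x (isClosed_eq (hc.comp hc) continuous_id) ?_
    intro a
    simp only [UniformSpace.Completion.map_coe p.uniformContinuous_star, star_star]
  star_mul x y := by
    have hc : Continuous (UniformSpace.Completion.map (star : p.Carrier → p.Carrier)) :=
      UniformSpace.Completion.continuous_map
    refine UniformSpace.Completion.induction_on₂ x y (isClosed_eq (by fun_prop) (by fun_prop)) ?_
    intro a b
    simp only [UniformSpace.Completion.map_coe p.uniformContinuous_star, star_mul,
      ← UniformSpace.Completion.coe_mul]
  star_add x y := by
    have hc : Continuous (UniformSpace.Completion.map (star : p.Carrier → p.Carrier)) :=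
      UniformSpace.Completion.continuous_map
    refine UniformSpace.Completion.induction_on₂ x y (isClosed_eq (by fun_prop) (by fun_prop)) ?_
    intro a b
    simp only [UniformSpace.Completion.map_coe p.uniformContinuous_star, star_add,
      ← UniformSpace.Completion.coe_add]

theorem coe_star (a : p.Carrier) : ((star a : p.Carrier) : p.Envelope) = star (a : p.Envelope) :=
  (UniformSpace.Completion.map_coe p.uniformContinuous_star a).symm

theorem continuous_star_envelope : Continuous (star : p.Envelope → p.Envelope) :=
  UniformSpace.Completion.continuous_map

theorem norm_mul_self_le_envelope (x : p.Envelope) : ‖x‖ * ‖x‖ ≤ ‖star x * x‖ := by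
  have hc := p.continuous_star_envelope
  refine UniformSpace.Completion.induction_on x (isClosed_le (by fun_prop) (by fun_prop)) ?_
  intro a
  rw [← coe_star, ← UniformSpace.Completion.coe_mul, UniformSpace.Completion.norm_coe,
    UniformSpace.Completion.norm_coe]
  exact (p.star_mul_self (show F from a)).ge

instance : NormedAlgebra ℂ p.Envelope where
  __ := (inferInstance : Algebra ℂ p.Envelope)
  norm_smul_le := norm_smul_le

theorem star_smul_envelope (c : ℂ) (x : p.Envelope) : star (c • x) = star c • star x := by
  have hc := p.continuous_star_envelope
  refine UniformSpace.Completion.induction_on x (isClosed_eq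
    (hc.comp (continuous_const_smul c)) ((continuous_const_smul (star c)).comp hc)) ?_
  intro a
  rw [← UniformSpace.Completion.coe_smul, ← coe_star, ← coe_star, star_smul,
    UniformSpace.Completion.coe_smul]

instance : CStarAlgebra p.Envelope where
  __ := (inferInstance : NormedRing p.Envelope)
  __ := (inferInstance : StarRing p.Envelope)
  __ := (inferInstance : NormedAlgebra ℂ p.Envelope)
  complete := CompleteSpace.complete
  norm_mul_self_le := p.norm_mul_self_le_envelope
  star_smul := p.star_smul_envelope

/-- The canonical `*`-homomorphism from `F` to the C⋆-algebra defined by `p`. -/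
def of : F →⋆ₐ[ℂ] p.Envelope where
  toFun x := ((show p.Carrier from x : p.Carrier) : p.Envelope)
  map_one' := rfl
  map_mul' x y := UniformSpace.Completion.coe_mul (show p.Carrier from x) (show p.Carrier from y)
  map_zero' := rfl
  map_add' x y := UniformSpace.Completion.coe_add (show p.Carrier from x) (show p.Carrier from y)
  commutes' _ := rfl
  map_star' x := p.coe_star x

theorem norm_of (x : F) : ‖p.of x‖ = p x :=
  UniformSpace.Completion.norm_coe (E := p.Carrier) x

theorem denseRange_of : DenseRange p.of :=
  UniformSpace.Completion.denseRange_coe (α := p.Carrier)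

section Lift

variable {p} {B : Type*} [CStarAlgebra B]

theorem continuous_carrier (f : F →⋆ₐ[ℂ] B) (h : ∀ x, ‖f x‖ ≤ p x) :
    Continuous (fun x : p.Carrier => f (show F from x)) :=
  let g : p.Carrier →+* B := (f : F →+* B)
  AddMonoidHomClass.continuous_of_bound g 1 (fun x => by rw [one_mul]; exact h x)

/-- A `*`-homomorphism `f` from `F` to a C⋆-algebra with `‖f x‖ ≤ p x` extends to the C⋆-algebra
defined by `p`. -/
def lift (f : F →⋆ₐ[ℂ] B) (h : ∀ x, ‖f x‖ ≤ p x) : p.Envelope →⋆ₐ[ℂ] B :=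
  let g : p.Carrier →+* B := (f : F →+* B)
  have hg : Continuous g := continuous_carrier f h
  { UniformSpace.Completion.extensionHom g hg with
    commutes' := fun c => by
      have := UniformSpace.Completion.extensionHom_coe g hg (algebraMap ℂ p.Carrier c)
      exact this.trans (AlgHomClass.commutes f c)
    map_star' := fun x => by
      have hc := p.continuous_star_envelope
      have he : Continuous (UniformSpace.Completion.extensionHom g hg) :=
        UniformSpace.Completion.continuous_extension
      refine UniformSpace.Completion.induction_on x
        (isClosed_eq (he.comp hc) (he.star)) ?_
      intro a
      change UniformSpace.Completion.extensionHom g hg _ =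
        star (UniformSpace.Completion.extensionHom g hg _)
      rw [← coe_star, UniformSpace.Completion.extensionHom_coe,
        UniformSpace.Completion.extensionHom_coe]
      exact StarHomClass.map_star f a }

theorem lift_of (f : F →⋆ₐ[ℂ] B) (h : ∀ x, ‖f x‖ ≤ p x) (x : F) : lift f h (p.of x) = f x :=
  UniformSpace.Completion.extensionHom_coe (α := p.Carrier) (f : F →+* B) (continuous_carrier f h) x

/-- The C⋆-seminorm `x ↦ ‖f x‖` defined by a `*`-homomorphism to a C⋆-algebra. -/
def ofHom (f : F →⋆ₐ[ℂ] B) : CStarSeminorm F where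
  toSeminorm := (normSeminorm ℂ B).comp (f : F →ₗ[ℂ] B)
  mul_le' x y := by
    change ‖f (x * y)‖ ≤ ‖f x‖ * ‖f y‖
    rw [map_mul]
    exact norm_mul_le _ _
  star_mul_self' x := by
    change ‖f (star x * x)‖ = ‖f x‖ * ‖f x‖
    rw [map_mul, StarHomClass.map_star, CStarRing.norm_star_mul_self]

set_option linter.unusedSectionVars false in
theorem ofHom_apply (f : F →⋆ₐ[ℂ] B) (x : F) : ofHom f x = ‖f x‖ := rfl

end Lift

end CStarSeminorm

/-! ### The free `*`-algebra on self-adjoint generators -/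

/-- The free unital complex `*`-algebra on `n` self-adjoint generators. -/
def FreeSelfAdjoint (n : ℕ) : Type := FreeAlgebra ℂ (Fin n)

namespace FreeSelfAdjoint

variable {n : ℕ}

instance : Ring (FreeSelfAdjoint n) := inferInstanceAs (Ring (FreeAlgebra ℂ (Fin n)))
instance : Algebra ℂ (FreeSelfAdjoint n) := inferInstanceAs (Algebra ℂ (FreeAlgebra ℂ (Fin n)))

/-- The generators. -/
def gen (i : Fin n) : FreeSelfAdjoint n := FreeAlgebra.ι ℂ i

theorem induction {C : FreeSelfAdjoint n → Prop}
    (algebraMap : ∀ c : ℂ, C (algebraMap ℂ (FreeSelfAdjoint n) c)) (gen : ∀ i, C (gen i))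
    (mul : ∀ a b, C a → C b → C (a * b)) (add : ∀ a b, C a → C b → C (a + b))
    (a : FreeSelfAdjoint n) : C a :=
  FreeAlgebra.induction ℂ (Fin n) algebraMap gen mul add a

/-- The conjugate-linear antimultiplicative map that fixes the generators: it is obtained from the
universal property of the free algebra, applied to the opposite ring with the conjugate complex
structure. -/
def starAux (n : ℕ) : FreeSelfAdjoint n →+* (FreeSelfAdjoint n)ᵐᵒᵖ :=
  letI : Algebra ℂ (FreeSelfAdjoint n)ᵐᵒᵖ :=
    ((algebraMap ℂ (FreeSelfAdjoint n)ᵐᵒᵖ).comp (starRingEnd ℂ)).toAlgebra'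
      (fun c x => Algebra.commutes (starRingEnd ℂ c) x)
  ((FreeAlgebra.lift ℂ (fun i : Fin n => MulOpposite.op (gen i)) :
    FreeAlgebra ℂ (Fin n) →ₐ[ℂ] (FreeSelfAdjoint n)ᵐᵒᵖ) :
      FreeAlgebra ℂ (Fin n) →+* (FreeSelfAdjoint n)ᵐᵒᵖ)

theorem starAux_gen (i : Fin n) : starAux n (gen i) = MulOpposite.op (gen i) :=
  letI : Algebra ℂ (FreeSelfAdjoint n)ᵐᵒᵖ :=
    ((algebraMap ℂ (FreeSelfAdjoint n)ᵐᵒᵖ).comp (starRingEnd ℂ)).toAlgebra'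
      (fun c x => Algebra.commutes (starRingEnd ℂ c) x)
  FreeAlgebra.lift_ι_apply (R := ℂ) (fun i : Fin n => MulOpposite.op (gen i)) i

theorem starAux_algebraMap (c : ℂ) :
    starAux n (algebraMap ℂ _ c) = MulOpposite.op (algebraMap ℂ _ (star c)) :=
  letI : Algebra ℂ (FreeSelfAdjoint n)ᵐᵒᵖ :=
    ((algebraMap ℂ (FreeSelfAdjoint n)ᵐᵒᵖ).comp (starRingEnd ℂ)).toAlgebra'
      (fun c x => Algebra.commutes (starRingEnd ℂ c) x)
  AlgHom.commutes (FreeAlgebra.lift ℂ (fun i : Fin n => MulOpposite.op (gen i)) :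
    FreeAlgebra ℂ (Fin n) →ₐ[ℂ] (FreeSelfAdjoint n)ᵐᵒᵖ) c

instance : StarRing (FreeSelfAdjoint n) where
  star x := (starAux n x).unop
  star_involutive x := by
    refine induction (C := fun x => (starAux n (starAux n x).unop).unop = x) ?_ ?_ ?_ ?_ x
    · intro c
      simp only [starAux_algebraMap, MulOpposite.unop_op, star_star]
    · intro i
      simp only [starAux_gen, MulOpposite.unop_op]
    · intro a b ha hb
      simp only [map_mul, MulOpposite.unop_mul, ha, hb]
    · intro a b ha hb
      simp only [map_add, MulOpposite.unop_add, ha, hb]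
  star_mul a b := by simp only [map_mul, MulOpposite.unop_mul]
  star_add a b := by simp only [map_add, MulOpposite.unop_add]

theorem star_gen (i : Fin n) : star (gen i) = gen i :=
  congrArg MulOpposite.unop (starAux_gen i)

theorem star_algebraMap (c : ℂ) :
    star (algebraMap ℂ (FreeSelfAdjoint n) c) = algebraMap ℂ (FreeSelfAdjoint n) (star c) :=
  congrArg MulOpposite.unop (starAux_algebraMap c)

instance : StarModule ℂ (FreeSelfAdjoint n) where
  star_smul c x := by
    rw [Algebra.smul_def, star_mul, star_algebraMap, Algebra.smul_def, Algebra.commutes]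

/-- The `*`-homomorphism defined by a family of self-adjoint elements. -/
def lift {B : Type*} [Ring B] [StarRing B] [Algebra ℂ B] [StarModule ℂ B] (b : Fin n → B)
    (hb : ∀ i, star (b i) = b i) : FreeSelfAdjoint n →⋆ₐ[ℂ] B :=
  let f : FreeSelfAdjoint n →ₐ[ℂ] B := FreeAlgebra.lift ℂ b
  { f with
    map_star' := fun x => by
      change f (star x) = star (f x)
      have hgen : ∀ i, f (gen i) = b i := fun i => FreeAlgebra.lift_ι_apply (R := ℂ) b i
      refine induction (C := fun x => f (star x) = star (f x)) ?_ ?_ ?_ ?_ x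
      · intro c
        rw [star_algebraMap, AlgHom.commutes, AlgHom.commutes, algebraMap_star_comm]
      · intro i
        rw [star_gen, hgen, hb]
      · intro a b ha hb
        rw [star_mul, map_mul, map_mul, star_mul, ha, hb]
      · intro a b ha hb
        rw [star_add, map_add, map_add, star_add, ha, hb] }

theorem lift_gen {B : Type*} [Ring B] [StarRing B] [Algebra ℂ B] [StarModule ℂ B]
    (b : Fin n → B) (hb : ∀ i, star (b i) = b i) (i : Fin n) : lift b hb (gen i) = b i :=
  FreeAlgebra.lift_ι_apply (R := ℂ) b i

end FreeSelfAdjoint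

/-! ### The half-liberated sphere -/

/-- The defining relations of the half-liberated real sphere, for a family of elements of a
`*`-ring. -/
structure HalfLiberatedRelations {n : ℕ} {B : Type*} [Ring B] [StarRing B] (b : Fin n → B) :
    Prop where
  sum_sq : ∑ i, b i ^ 2 = 1
  star_eq : ∀ i, star (b i) = b i
  half_comm : ∀ i j k, b i * b j * b k = b k * b j * b i

namespace HalfLiberatedRelations

theorem norm_le_one {n : ℕ} {B : Type*} [CStarAlgebra B] {b : Fin n → B}
    (hb : HalfLiberatedRelations b) (i : Fin n) : ‖b i‖ ≤ 1 := by
  let _ : PartialOrder B := CStarAlgebra.spectralOrder B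
  have _ : StarOrderedRing B := CStarAlgebra.spectralOrderedRing B
  rcases subsingleton_or_nontrivial B with _ | _
  · rw [Subsingleton.elim (b i) 0, norm_zero]
    exact zero_le_one
  have hpos : ∀ j, 0 ≤ b j ^ 2 := fun j => by
    have := star_mul_self_nonneg (b j)
    rwa [hb.star_eq, ← pow_two] at this
  have hle : b i ^ 2 ≤ 1 := by
    rw [← hb.sum_sq]
    exact Finset.single_le_sum (fun j _ => hpos j) (Finset.mem_univ i)
  have h := CStarAlgebra.norm_le_norm_of_nonneg_of_le (hpos i) hle
  have h2 : ‖b i ^ 2‖ = ‖b i‖ * ‖b i‖ := by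
    rw [← CStarRing.norm_star_mul_self (x := b i), hb.star_eq, pow_two]
  rw [h2, CStarRing.norm_one] at h
  nlinarith [norm_nonneg (b i)]

end HalfLiberatedRelations

namespace HalfLiberatedSphere

open FreeSelfAdjoint

variable {n : ℕ}

/-- The C⋆-seminorms on the free `*`-algebra on self-adjoint generators `v₁, …, vₙ` that vanish on
the relators `∑ vᵢ² - 1` and `vᵢ vⱼ vₖ - vₖ vⱼ vᵢ`. -/
structure Admissible (p : CStarSeminorm (FreeSelfAdjoint n)) : Prop where
  sum_sq : p (∑ i, gen i ^ 2 - 1) = 0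
  half_comm : ∀ i j k, p (gen i * gen j * gen k - gen k * gen j * gen i) = 0

theorem Admissible.relations {p : CStarSeminorm (FreeSelfAdjoint n)} (hp : Admissible p) :
    HalfLiberatedRelations (fun i => p.of (gen i)) where
  sum_sq := by
    have h := hp.sum_sq
    rw [← p.norm_of, norm_eq_zero, map_sub, sub_eq_zero, map_one, map_sum] at h
    simpa only [map_pow] using h
  star_eq i := by rw [← map_star, star_gen]
  half_comm i j k := by
    have h := hp.half_comm i j k
    rw [← p.norm_of, norm_eq_zero, map_sub, sub_eq_zero] at h
    simpa only [map_mul] using h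

theorem admissible_ofHom {B : Type*} [CStarAlgebra B] {b : Fin n → B}
    (hb : HalfLiberatedRelations b) :
    Admissible (CStarSeminorm.ofHom (FreeSelfAdjoint.lift b hb.star_eq)) where
  sum_sq := by
    rw [CStarSeminorm.ofHom_apply, map_sub, map_sum, map_one]
    simp only [map_pow, lift_gen, hb.sum_sq, sub_self, norm_zero]
  half_comm i j k := by
    rw [CStarSeminorm.ofHom_apply, map_sub]
    simp only [map_mul, lift_gen, hb.half_comm i j k, sub_self, norm_zero]

theorem admissible_zero : Admissible (CStarSeminorm.zero (FreeSelfAdjoint n)) where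
  sum_sq := rfl
  half_comm _ _ _ := rfl

instance : Nonempty {p : CStarSeminorm (FreeSelfAdjoint n) // Admissible p} :=
  ⟨⟨_, admissible_zero⟩⟩

theorem exists_bound (x : FreeSelfAdjoint n) :
    ∃ M : ℝ, ∀ p : {p : CStarSeminorm (FreeSelfAdjoint n) // Admissible p}, p.1 x ≤ M := by
  refine FreeSelfAdjoint.induction (C := fun x => ∃ M : ℝ,
    ∀ p : {p : CStarSeminorm (FreeSelfAdjoint n) // Admissible p}, p.1 x ≤ M) ?_ ?_ ?_ ?_ x
  · intro c
    refine ⟨‖c‖ * 1, fun p => ?_⟩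
    rw [Algebra.algebraMap_eq_smul_one, map_smul_eq_mul]
    refine mul_le_mul_of_nonneg_left ?_ (norm_nonneg c)
    have h := p.1.star_mul_self 1
    rw [star_one, one_mul] at h
    nlinarith [p.1.nonneg 1, sq_nonneg (p.1 1 - 1)]
  · intro i
    refine ⟨1, fun p => ?_⟩
    rw [← p.1.norm_of]
    exact p.2.relations.norm_le_one i
  · rintro a b ⟨M, hM⟩ ⟨N, hN⟩
    refine ⟨M * N, fun p => (p.1.mul_le a b).trans ?_⟩
    exact mul_le_mul (hM p) (hN p) (p.1.nonneg b) ((p.1.nonneg a).trans (hM p))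
  · rintro a b ⟨M, hM⟩ ⟨N, hN⟩
    exact ⟨M + N, fun p => (map_add_le_add p.1.toSeminorm a b).trans (add_le_add (hM p) (hN p))⟩

theorem bddAbove (x : FreeSelfAdjoint n) :
    BddAbove (Set.range fun p : {p : CStarSeminorm (FreeSelfAdjoint n) // Admissible p} =>
      p.1 x) := by
  obtain ⟨M, hM⟩ := exists_bound x
  exact ⟨M, by rintro _ ⟨p, rfl⟩; exact hM p⟩

/-- The largest C⋆-seminorm on the free `*`-algebra on self-adjoint generators that vanishes on the
relators. -/
def maxSeminorm (n : ℕ) : CStarSeminorm (FreeSelfAdjoint n) where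
  toSeminorm := Seminorm.of
    (fun x => ⨆ p : {p : CStarSeminorm (FreeSelfAdjoint n) // Admissible p}, p.1 x)
    (fun x y => ciSup_le fun p => (map_add_le_add p.1.toSeminorm x y).trans
      (add_le_add (le_ciSup (bddAbove x) p) (le_ciSup (bddAbove y) p)))
    (fun c x => by
      simp only [map_smul_eq_mul]
      exact (Real.mul_iSup_of_nonneg (norm_nonneg c) _).symm)
  mul_le' x y := ciSup_le fun p => (p.1.mul_le x y).trans
    (mul_le_mul (le_ciSup (bddAbove x) p) (le_ciSup (bddAbove y) p) (p.1.nonneg y)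
      ((p.1.nonneg x).trans (le_ciSup (bddAbove x) p)))
  star_mul_self' x := by
    have h0 : 0 ≤ ⨆ p : {p : CStarSeminorm (FreeSelfAdjoint n) // Admissible p}, p.1 x :=
      Real.iSup_nonneg fun p => p.1.nonneg x
    refine le_antisymm (ciSup_le fun p => ?_) ?_
    · rw [p.1.star_mul_self]
      exact mul_self_le_mul_self (p.1.nonneg x) (le_ciSup (bddAbove x) p)
    · change (⨆ p : {p : CStarSeminorm (FreeSelfAdjoint n) // Admissible p}, p.1 x) *
        (⨆ p : {p : CStarSeminorm (FreeSelfAdjoint n) // Admissible p}, p.1 x) ≤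
        ⨆ p : {p : CStarSeminorm (FreeSelfAdjoint n) // Admissible p}, p.1 (star x * x)
      rw [Real.mul_iSup_of_nonneg h0]
      refine ciSup_le fun q => ?_
      rw [Real.iSup_mul_of_nonneg (q.1.nonneg x)]
      refine ciSup_le fun p => ?_
      rcases le_total (p.1 x) (q.1 x) with h | h
      · refine (mul_le_mul_of_nonneg_right h (q.1.nonneg x)).trans ?_
        rw [← q.1.star_mul_self]
        exact le_ciSup (bddAbove (star x * x)) q
      · refine (mul_le_mul_of_nonneg_left h (p.1.nonneg x)).trans ?_
        rw [← p.1.star_mul_self]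
        exact le_ciSup (bddAbove (star x * x)) p

theorem le_maxSeminorm {p : CStarSeminorm (FreeSelfAdjoint n)} (hp : Admissible p)
    (x : FreeSelfAdjoint n) : p x ≤ maxSeminorm n x :=
  le_ciSup (bddAbove x) (⟨p, hp⟩ : {p : CStarSeminorm (FreeSelfAdjoint n) // Admissible p})

theorem admissible_maxSeminorm : Admissible (maxSeminorm n) where
  sum_sq := le_antisymm (ciSup_le fun p => p.2.sum_sq.le) ((maxSeminorm n).nonneg _)
  half_comm i j k :=
    le_antisymm (ciSup_le fun p => (p.2.half_comm i j k).le) ((maxSeminorm n).nonneg _)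

end HalfLiberatedSphere

/-- The C⋆-algebra `C(S^{n-1}_{ℝ,*})` of the half-liberated real sphere: the universal unital
C⋆-algebra on self-adjoint generators `v₁, …, vₙ` subject to `∑ vᵢ² = 1` and
`vᵢ vⱼ vₖ = vₖ vⱼ vᵢ`, i.e. the separated completion of the free `*`-algebra for the largest
C⋆-seminorm that vanishes on the relators. -/
def HalfLiberatedSphere (n : ℕ) : Type := (HalfLiberatedSphere.maxSeminorm n).Envelope

namespace HalfLiberatedSphere

open FreeSelfAdjoint

variable {n : ℕ}

instance : CStarAlgebra (HalfLiberatedSphere n) :=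
  inferInstanceAs (CStarAlgebra (maxSeminorm n).Envelope)

/-- The standard generators `v₁, …, vₙ`. -/
def v (i : Fin n) : HalfLiberatedSphere n := (maxSeminorm n).of (gen i)

theorem relations : HalfLiberatedRelations (v : Fin n → HalfLiberatedSphere n) :=
  admissible_maxSeminorm.relations

section Universal

variable {B : Type*} [CStarAlgebra B]

/-- Universal property of `C(S^{n-1}_{ℝ,*})`: a family of elements of a unital C⋆-algebra (in any
universe) satisfying the relations defines a `*`-homomorphism. -/
def lift (b : Fin n → B) (hb : HalfLiberatedRelations b) : HalfLiberatedSphere n →⋆ₐ[ℂ] B :=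
  CStarSeminorm.lift (p := maxSeminorm n) (FreeSelfAdjoint.lift b hb.star_eq)
    (fun x => le_maxSeminorm (admissible_ofHom hb) x)

theorem lift_v (b : Fin n → B) (hb : HalfLiberatedRelations b) (i : Fin n) :
    lift b hb (v i) = b i :=
  (CStarSeminorm.lift_of (p := maxSeminorm n) _ _ _).trans (FreeSelfAdjoint.lift_gen _ _ i)

theorem hom_ext {f g : HalfLiberatedSphere n →⋆ₐ[ℂ] B} (h : ∀ i, f (v i) = g (v i)) : f = g := by
  have hf : Continuous f := 
    AddMonoidHomClass.continuous_of_bound f 1 (fun x => by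
      rw [one_mul]; exact NonUnitalStarAlgHom.norm_apply_le f x)
  have hg : Continuous g := 
    AddMonoidHomClass.continuous_of_bound g 1 (fun x => by
      rw [one_mul]; exact NonUnitalStarAlgHom.norm_apply_le g x)
  refine DFunLike.coe_injective ((maxSeminorm n).denseRange_of.equalizer hf hg ?_)
  funext x
  refine FreeSelfAdjoint.induction
    (C := fun x => f ((maxSeminorm n).of x) = g ((maxSeminorm n).of x)) ?_ h ?_ ?_ x
  · intro c
    rw [AlgHomClass.commutes ((maxSeminorm n).of) c]
    exact (AlgHomClass.commutes f c).trans (AlgHomClass.commutes g c).symm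
  · intro a b ha hb
    rw [map_mul ((maxSeminorm n).of)]
    exact (map_mul f _ _).trans ((congrArg₂ _ ha hb).trans (map_mul g _ _).symm)
  · intro a b ha hb
    rw [map_add ((maxSeminorm n).of)]
    exact (map_add f _ _).trans ((congrArg₂ _ ha hb).trans (map_add g _ _).symm)

end Universal

theorem relations_neg : HalfLiberatedRelations (fun i : Fin n => -(v i : HalfLiberatedSphere n)) where
  sum_sq := by simpa only [neg_sq] using relations.sum_sq
  star_eq i := by rw [star_neg, relations.star_eq]
  half_comm i j k := by simp only [neg_mul, mul_neg, relations.half_comm i j k]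

/-- The sign endomorphism `vᵢ ↦ -vᵢ`. -/
def signHom (n : ℕ) : HalfLiberatedSphere n →⋆ₐ[ℂ] HalfLiberatedSphere n :=
  lift (fun i => -(v i)) relations_neg

theorem signHom_comp : (signHom n).comp (signHom n) = StarAlgHom.id ℂ (HalfLiberatedSphere n) :=
  hom_ext fun i => by
    simp only [StarAlgHom.comp_apply, signHom, lift_v, map_neg, neg_neg]
    rfl

/-- The sign automorphism `ν` of `C(S^{n-1}_{ℝ,*})`, with `ν(vᵢ) = -vᵢ`. -/
def sign (n : ℕ) : HalfLiberatedSphere n ≃⋆ₐ[ℂ] HalfLiberatedSphere n :=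
  StarAlgEquiv.ofStarAlgHom (signHom n) (signHom n) signHom_comp signHom_comp

theorem sign_v (i : Fin n) : sign n (v i) = -(v i) := lift_v _ relations_neg i

/-- The even part `C(S^{n-1}_{ℝ,*})₀ = {a | ν(a) = a}`. -/
def even (n : ℕ) : StarSubalgebra ℂ (HalfLiberatedSphere n) where
  carrier := {a | sign n a = a}
  mul_mem' {a b} ha hb := by
    change sign n (a * b) = a * b
    rw [map_mul, show sign n a = a from ha, show sign n b = b from hb]
  add_mem' {a b} ha hb := by
    change sign n (a + b) = a + b
    rw [map_add, show sign n a = a from ha, show sign n b = b from hb]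
  algebraMap_mem' c := AlgHomClass.commutes (signHom n) c
  star_mem' {a} ha := by
    change sign n (star a) = star a
    rw [map_star, show sign n a = a from ha]

/-- The odd part `C(S^{n-1}_{ℝ,*})₁ = {a | ν(a) = -a}`. -/
def odd (n : ℕ) : Submodule ℂ (HalfLiberatedSphere n) where
  carrier := {a | sign n a = -a}
  zero_mem' := by
    change sign n 0 = -0
    rw [map_zero, neg_zero]
  add_mem' {a b} ha hb := by
    change sign n (a + b) = -(a + b)
    rw [map_add, show sign n a = -a from ha, show sign n b = -b from hb, neg_add]
  smul_mem' c a ha := by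
    change sign n (c • a) = -(c • a)
    rw [map_smul, show sign n a = -a from ha, smul_neg]

end HalfLiberatedSphere

/-! ### Quantum subspaces -/

/-- A quantum subspace `X` of the quantum space of a C⋆-algebra `A`: a quotient C⋆-algebra
`C(X) = A ⧸ I` of `A`, i.e. a closed two-sided ideal `I` of `A` (automatically self-adjoint). The
zero quotient corresponds to the empty subspace. -/
@[ext]
structure QuantumSubspace (A : Type*) [CStarAlgebra A] where
  ideal : TwoSidedIdeal A
  isClosed : IsClosed (ideal : Set A)

namespace HalfLiberatedSphere

variable {n : ℕ}

/-- A quantum subspace of the half-liberated sphere is symmetric if its ideal `I` is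
`ℤ₂`-graded: `I = (I ∩ C(S^{n-1}_{ℝ,*})₀) ⊕ (I ∩ C(S^{n-1}_{ℝ,*})₁)`. -/
def IsSymmetric (X : QuantumSubspace (HalfLiberatedSphere n)) : Prop :=
  ∀ a ∈ X.ideal, ∃! c : HalfLiberatedSphere n × HalfLiberatedSphere n,
    (c.1 ∈ X.ideal ∧ c.1 ∈ even n) ∧ (c.2 ∈ X.ideal ∧ c.2 ∈ odd n) ∧ a = c.1 + c.2

end HalfLiberatedSphere

/-! ### The complex projective space -/

/-- The complex sphere `S^{n-1}_ℂ`, the unit sphere of `ℂⁿ`. -/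
abbrev ComplexSphere (n : ℕ) : Type := Metric.sphere (0 : EuclideanSpace ℂ (Fin n)) 1

/-- The complex projective space `P^{n-1}_ℂ`: the orbit space, with the quotient topology, of the
action of the group `𝕋` of complex numbers of modulus `1` on the complex sphere. -/
abbrev ComplexProjectiveSpace (n : ℕ) : Type :=
  MulAction.orbitRel.Quotient (Metric.sphere (0 : ℂ) 1) (ComplexSphere n)

namespace ComplexProjectiveSpace

variable {n : ℕ}

/-- The complex conjugation of the complex sphere. -/
def sphereConj (z : ComplexSphere n) : ComplexSphere n :=
  ⟨WithLp.toLp 2 fun i => star (z.1 i), by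
    have h := mem_sphere_zero_iff_norm.1 z.2
    rw [EuclideanSpace.norm_eq] at h
    rw [mem_sphere_zero_iff_norm, EuclideanSpace.norm_eq]
    simpa only [norm_star] using h⟩

/-- The complex conjugation of the complex projective space. -/
def conj : ComplexProjectiveSpace n → ComplexProjectiveSpace n :=
  Quotient.map' sphereConj (by
    rintro z w ⟨ω, rfl⟩
    refine ⟨⟨star ω.1, by simp⟩, ?_⟩
    apply Subtype.ext
    ext i
    exact (map_mul (starRingEnd ℂ) ω.1 (w.1 i)).symm)

/-- The continuous function `zᵢ zⱼ^*` on the complex projective space. -/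
def coordFun (i j : Fin n) : C(ComplexProjectiveSpace n, ℂ) where
  toFun := Quotient.lift (fun z : ComplexSphere n => z.1 i * star (z.1 j)) (by
    rintro z w ⟨ω, rfl⟩
    have hω : ω.1 * star ω.1 = 1 := by
      have h := mem_sphere_zero_iff_norm.1 ω.2
      rw [Complex.star_def, Complex.mul_conj, Complex.normSq_eq_norm_sq, h]
      simp
    change ω.1 * w.1 i * star (ω.1 * w.1 j) = w.1 i * star (w.1 j)
    rw [star_mul']
    linear_combination (w.1 i * star (w.1 j)) * hω)
  continuous_toFun := Continuous.quotient_lift (by fun_prop) _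

/-- The functions vanishing on `Y` (the underlying set of the ideal `J_Y` of
`C(P^{n-1}_ℂ)`). -/
def vanishing (Y : Set (ComplexProjectiveSpace n)) : Set C(ComplexProjectiveSpace n, ℂ) :=
  {f | ∀ y ∈ Y, f y = 0}

/-- The conjugation-stable closed subspaces of the complex projective space. -/
abbrev ConjStableClosed (n : ℕ) : Type :=
  {Y : TopologicalSpace.Closeds (ComplexProjectiveSpace n) //
    ∀ y ∈ Y, conj y ∈ Y}

end ComplexProjectiveSpace

end

/-! ### The even part: generation by the products `v i * v j`, and commutativity -/

namespace HalfLiberatedSphere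

open FreeSelfAdjoint

variable {n : ℕ}

/-! The half-commutation relations make the products `v i * v j` commute, and these products
generate the even part as a closed subalgebra (`mem_of_mem_even`), so the even part is a commutative
C⋆-algebra. A character χ of it is determined by the matrix χ(vᵢvⱼ). The relations force this matrix
to be hermitian of trace one with vanishing 2 × 2 minors, hence of the form zᵢz̄ⱼ for a unit vector
z, unique up to phase. Conversely every z occurs, because the antidiagonal matrices (0, zᵢ; z̄ᵢ, 0)
satisfy the relations. Gelfand duality and Stone–Weierstrass then identify the even part with the
continuous functions on projective space.

For ideals, Σ vᵢ² = 1 gives c = Σ vᵢ(vᵢc). When c is odd each vᵢc is even, so a graded ideal is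
generated by its even elements (`span_even_eq`). It remains to see which closed ideals of functions
arise as even parts. In the matrix model an even element is diagonal, and its second entry is its
first entry at the conjugate point. The operation a ↦ Σ vₖavₖ therefore acts on functions as
conjugation and preserves every two-sided ideal, so the zero set is conjugation-stable. Conversely,
for conjugation-stable Y, the elements whose model vanishes over Y form a closed graded ideal whose
even part is exactly the ideal of functions vanishing on Y. -/

theorem continuous_sign : Continuous (sign n) :=
  AddMonoidHomClass.continuous_of_bound (sign n) 1 (fun x => by
    rw [one_mul]; exact NonUnitalStarAlgHom.norm_apply_le (sign n) x)

theorem sign_sign (a : HalfLiberatedSphere n) : sign n (sign n a) = a :=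
  DFunLike.congr_fun (signHom_comp (n := n)) a

theorem mem_even {a : HalfLiberatedSphere n} : a ∈ even n ↔ sign n a = a := Iff.rfl

theorem mem_odd {a : HalfLiberatedSphere n} : a ∈ odd n ↔ sign n a = -a := Iff.rfl

theorem isClosed_even : IsClosed (even n : Set (HalfLiberatedSphere n)) :=
  isClosed_eq continuous_sign continuous_id

theorem eq_zero_of_mem_even_of_mem_odd {a : HalfLiberatedSphere n} (h : a ∈ even n)
    (h' : a ∈ odd n) : a = 0 := by
  have h2 : (2 : ℂ) • a = 0 := by
    rw [two_smul]
    nth_rewrite 2 [(mem_even.mp h).symm.trans (mem_odd.mp h')]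
    exact add_neg_cancel a
  exact (smul_eq_zero.mp h2).resolve_left two_ne_zero

theorem v_mul_v_mem_even (i j : Fin n) : v i * v j ∈ even n := by
  rw [mem_even, map_mul, sign_v, sign_v, neg_mul_neg]

theorem v_mul_mem_even {a : HalfLiberatedSphere n} (ha : a ∈ odd n) (i : Fin n) :
    v i * a ∈ even n := by
  rw [mem_even, map_mul, sign_v, mem_odd.mp ha, neg_mul_neg]

theorem v_mul_mul_v_mem_even {a : HalfLiberatedSphere n} (ha : a ∈ even n) (i j : Fin n) :
    v i * a * v j ∈ even n := by
  rw [mem_even, map_mul, map_mul, sign_v, sign_v, mem_even.mp ha, neg_mul, neg_mul_neg]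

/-- For odd `a` the inner factors `v i * a` are even, so this reduces questions about odd elements
to even ones. -/
theorem sum_v_mul_v_mul (a : HalfLiberatedSphere n) : ∑ i, v i * (v i * a) = a := by
  simp_rw [← mul_assoc, ← Finset.sum_mul, ← pow_two]
  rw [relations.sum_sq, one_mul]

theorem exists_even_add_odd (a : HalfLiberatedSphere n) :
    ∃ b ∈ even n, ∃ c ∈ odd n, a = b + c := by
  refine ⟨(1 / 2 : ℂ) • (a + sign n a), ?_, (1 / 2 : ℂ) • (a - sign n a), ?_, ?_⟩
  · rw [mem_even, map_smul, map_add, sign_sign, add_comm]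
  · rw [mem_odd, map_smul, map_sub, sign_sign, ← smul_neg, neg_sub]
  · module

/-- A closed subalgebra containing the generators is everything. -/
theorem mem_of_v_mem (S : Subalgebra ℂ (HalfLiberatedSphere n))
    (hS : IsClosed (S : Set (HalfLiberatedSphere n))) (h : ∀ i, v i ∈ S)
    (a : HalfLiberatedSphere n) : a ∈ S := by
  refine (maxSeminorm n).denseRange_of.induction_on (p := fun a => a ∈ S) a hS fun x => ?_
  refine FreeSelfAdjoint.induction (C := fun x => ((maxSeminorm n).of x : HalfLiberatedSphere n) ∈ S)
    ?_ h ?_ ?_ x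
  · intro c
    rw [AlgHomClass.commutes ((maxSeminorm n).of) c]
    exact S.algebraMap_mem c
  · intro a b ha hb
    rw [map_mul ((maxSeminorm n).of)]
    exact S.mul_mem ha hb
  · intro a b ha hb
    rw [map_add ((maxSeminorm n).of)]
    exact S.add_mem ha hb

/-- The even part is generated, as a closed subalgebra, by the products `vᵢ vⱼ`. -/
theorem mem_of_mem_even (S : Subalgebra ℂ (HalfLiberatedSphere n))
    (hS : IsClosed (S : Set (HalfLiberatedSphere n))) (h : ∀ i j, v i * v j ∈ S)
    {a : HalfLiberatedSphere n} (ha : a ∈ even n) : a ∈ S := by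
  have hν := continuous_sign (n := n)
  -- Up to a factor 2, `M` asks that the even part of `m` lie in `S` and that its odd part lie in
  -- `S` after right multiplication by any generator. `M` need not be an algebra, so the argument
  -- passes to its right multipliers `R`, which form a closed subalgebra.
  let M : Submodule ℂ (HalfLiberatedSphere n) :=
    { carrier := {m | m + sign n m ∈ S ∧ ∀ k, (m - sign n m) * v k ∈ S}
      zero_mem' := by simp [S.zero_mem]
      add_mem' := by
        rintro x y ⟨hx, hx'⟩ ⟨hy, hy'⟩
        refine ⟨?_, fun k => ?_⟩
        · rw [map_add, add_add_add_comm]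
          exact S.add_mem hx hy
        · rw [map_add, add_sub_add_comm, add_mul]
          exact S.add_mem (hx' k) (hy' k)
      smul_mem' := by
        rintro c x ⟨hx, hx'⟩
        refine ⟨?_, fun k => ?_⟩
        · rw [map_smul, ← smul_add]
          exact S.smul_mem hx c
        · rw [map_smul, ← smul_sub, smul_mul_assoc]
          exact S.smul_mem (hx' k) c }
  have hM : IsClosed (M : Set (HalfLiberatedSphere n)) := by
    have : (M : Set (HalfLiberatedSphere n)) = {m | m + sign n m ∈ S} ∩
        ⋂ k, {m | (m - sign n m) * v k ∈ S} := by
      ext m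
      simp only [Set.mem_inter_iff, Set.mem_iInter]
      rfl
    rw [this]
    refine (hS.preimage (continuous_id.add hν)).inter (isClosed_iInter fun k => ?_)
    exact hS.preimage ((continuous_id.sub hν).mul continuous_const)
  let R : Subalgebra ℂ (HalfLiberatedSphere n) :=
    { carrier := {r | ∀ m ∈ M, m * r ∈ M}
      mul_mem' := fun {x y} hx hy m hm => by
        rw [← mul_assoc]
        exact hy _ (hx m hm)
      add_mem' := fun {x y} hx hy m hm => by
        rw [mul_add]
        exact M.add_mem (hx m hm) (hy m hm)
      algebraMap_mem' := fun c m hm => by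
        rw [← Algebra.commutes, ← Algebra.smul_def]
        exact M.smul_mem c hm }
  have hR : IsClosed (R : Set (HalfLiberatedSphere n)) := by
    have : (R : Set (HalfLiberatedSphere n)) = ⋂ m ∈ M, {r | m * r ∈ M} := by
      ext r
      simp only [Set.mem_iInter]
      rfl
    rw [this]
    exact isClosed_biInter fun m _ => hM.preimage (continuous_const.mul continuous_id)
  -- Right multiplication by `v j` exchanges the even and odd parts, hence the two conditions
  -- defining `M`.
  have hv : ∀ j, v j ∈ R := by
    rintro j m ⟨hm, hm'⟩
    refine ⟨?_, fun k => ?_⟩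
    · rw [map_mul, sign_v, mul_neg, ← sub_eq_add_neg, ← sub_mul]
      exact hm' j
    · rw [map_mul, sign_v, mul_neg, sub_neg_eq_add, ← add_mul, mul_assoc]
      exact S.mul_mem hm (h j k)
  have h1 : (1 : HalfLiberatedSphere n) ∈ M := by
    refine ⟨?_, fun k => ?_⟩
    · rw [map_one]
      exact S.add_mem S.one_mem S.one_mem
    · rw [map_one, sub_self, zero_mul]
      exact S.zero_mem
  -- Every `a` lies in `R`, so `1 * a ∈ M`; for even `a` the first condition reads `a + a ∈ S`.
  have h2 := (mem_of_v_mem R hR hv a 1 h1).1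
  rw [one_mul, mem_even.mp ha] at h2
  have h3 := S.smul_mem h2 (1 / 2 : ℂ)
  rwa [← two_smul ℂ a, smul_smul, one_div, inv_mul_cancel₀ two_ne_zero, one_smul] at h3

/-- Under a character this becomes the vanishing of the 2 × 2 minors of the matrix χ(vᵢvⱼ). -/
theorem v_mul_v_mul_v_mul_v (i j k l : Fin n) :
    v i * v j * (v k * v l) = v k * v j * (v i * v l : HalfLiberatedSphere n) := by
  rw [← mul_assoc, ← mul_assoc, relations.half_comm i j k]

theorem commute_v_mul_v (i j k l : Fin n) :
    Commute (v i * v j) (v k * v l : HalfLiberatedSphere n) := by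
  change v i * v j * (v k * v l) = v k * v l * (v i * v j)
  calc v i * v j * (v k * v l) = v i * (v j * v k * v l) := by simp only [mul_assoc]
    _ = v i * (v l * v k * v j) := by rw [relations.half_comm j k l]
    _ = v i * v l * v k * v j := by simp only [mul_assoc]
    _ = v k * v l * v i * v j := by rw [relations.half_comm i l k]
    _ = _ := by simp only [mul_assoc]

theorem isClosed_centralizer (T : Set (HalfLiberatedSphere n)) :
    IsClosed (Subalgebra.centralizer ℂ T : Set (HalfLiberatedSphere n)) := by
  have : (Subalgebra.centralizer ℂ T : Set (HalfLiberatedSphere n)) =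
      ⋂ t ∈ T, {a | t * a = a * t} := by
    ext a
    simp [Set.mem_centralizer_iff]
  rw [this]
  exact isClosed_biInter fun t _ => isClosed_eq (continuous_const.mul continuous_id)
    (continuous_id.mul continuous_const)

/-- Centralizers are closed subalgebras, so commutation passes from the products `v i * v j` to all
even elements, one factor at a time. -/
theorem commute_of_mem_even {a b : HalfLiberatedSphere n} (ha : a ∈ even n) (hb : b ∈ even n) :
    Commute a b := by
  have h : ∀ i j : Fin n, ∀ c ∈ even n, v i * v j * c = c * (v i * v j) := fun i j c hc =>
    Subalgebra.mem_centralizer_iff ℂ |>.mp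
      (mem_of_mem_even (Subalgebra.centralizer ℂ {v i * v j}) (isClosed_centralizer _)
        (fun k l => (Subalgebra.mem_centralizer_iff ℂ).mpr (by
          rintro _ rfl
          exact commute_v_mul_v i j k l)) hc) _ rfl
  refine Subalgebra.mem_centralizer_iff ℂ |>.mp
    (mem_of_mem_even (Subalgebra.centralizer ℂ {a}) (isClosed_centralizer _)
      (fun k l => (Subalgebra.mem_centralizer_iff ℂ).mpr ?_) hb) _ rfl
  rintro _ rfl
  exact (h k l _ ha).symm

attribute [local instance] isClosed_even

/-- The even part is a commutative C⋆-algebra. -/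
noncomputable abbrev evenCommCStarAlgebra (n : ℕ) : CommCStarAlgebra (even n) where
  __ := (inferInstance : CStarAlgebra (even n))
  mul_comm a b := Subtype.ext (commute_of_mem_even a.2 b.2)

/-- The product `vᵢ vⱼ`, as an element of the even part. -/
noncomputable def vv (i j : Fin n) : even n := ⟨v i * v j, v_mul_v_mem_even i j⟩

/-- The equalizer of `f` and `g` is closed in the even part, hence in the whole algebra, where
`mem_of_mem_even` applies to it. -/
theorem even_hom_ext {B : Type*} [CStarAlgebra B] {f g : even n →⋆ₐ[ℂ] B}
    (h : ∀ i j, f (vv i j) = g (vv i j)) : f = g := by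
  have hf : Continuous f :=
    AddMonoidHomClass.continuous_of_bound f 1 (fun x => by
      rw [one_mul]; exact NonUnitalStarAlgHom.norm_apply_le f x)
  have hg : Continuous g :=
    AddMonoidHomClass.continuous_of_bound g 1 (fun x => by
      rw [one_mul]; exact NonUnitalStarAlgHom.norm_apply_le g x)
  let S : Subalgebra ℂ (HalfLiberatedSphere n) :=
    (AlgHom.equalizer (f : even n →ₐ[ℂ] B) (g : even n →ₐ[ℂ] B)).map
      ((even n).subtype : even n →ₐ[ℂ] HalfLiberatedSphere n)
  have hS : IsClosed (S : Set (HalfLiberatedSphere n)) :=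
    (isClosed_even (n := n)).isClosedMap_subtype_val _ (isClosed_eq hf hg)
  refine StarAlgHom.ext fun a => ?_
  obtain ⟨b, hb, hba⟩ := mem_of_mem_even S hS (fun i j => ⟨vv i j, h i j, rfl⟩) a.2
  rw [← show b = a from Subtype.ext hba]
  exact hb

end HalfLiberatedSphere

/-! ### The 2 × 2 matrix model and the characters of the even part -/

namespace HalfLiberatedSphere

open ComplexProjectiveSpace
open scoped ComplexOrder

attribute [local instance] isClosed_even

variable {n : ℕ}

theorem sum_mul_star_eq_one (z : ComplexSphere n) : ∑ i, z.1 i * star (z.1 i) = 1 := by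
  have h := mem_sphere_zero_iff_norm.1 z.2
  rw [EuclideanSpace.norm_eq, Real.sqrt_eq_one] at h
  simp_rw [Complex.star_def, Complex.mul_conj, Complex.normSq_eq_norm_sq]
  exact_mod_cast h

/-- The matrix `(0, zᵢ; z̄ᵢ, 0)`. -/
def modelMatrix (z : ComplexSphere n) (i : Fin n) : CStarMatrix (Fin 2) (Fin 2) ℂ :=
  CStarMatrix.ofMatrix !![0, z.1 i; star (z.1 i), 0]

theorem modelMatrix_apply (z : ComplexSphere n) (i : Fin n) (k l : Fin 2) :
    modelMatrix z i k l = !![0, z.1 i; star (z.1 i), 0] k l := rfl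

theorem continuous_modelMatrix (i : Fin n) :
    Continuous fun z : ComplexSphere n => modelMatrix z i := by
  refine continuous_pi fun k => continuous_pi fun l => ?_
  simp_rw [modelMatrix_apply]
  fin_cases k <;> fin_cases l <;> simp <;> fun_prop

/-- The function `z ↦ (0, zᵢ; z̄ᵢ, 0)` on the complex sphere. -/
def modelGen (i : Fin n) : C(ComplexSphere n, CStarMatrix (Fin 2) (Fin 2) ℂ) :=
  ⟨fun z => modelMatrix z i, continuous_modelMatrix i⟩

/-- A product of three such matrices is antidiagonal with entries zᵢz̄ⱼzₖ and z̄ᵢzⱼz̄ₖ, both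
symmetric in i and k. -/
theorem relations_modelGen : HalfLiberatedRelations (modelGen (n := n)) where
  sum_sq := by
    ext z k l
    have h := sum_mul_star_eq_one z
    have h' : ∑ i, star (z.1 i) * z.1 i = 1 := by simpa only [mul_comm] using h
    rw [ContinuousMap.sum_apply]
    have hs : (∑ i, (modelGen i ^ 2 : C(ComplexSphere n, CStarMatrix (Fin 2) (Fin 2) ℂ)) z) k l =
        ∑ i, ((modelGen i ^ 2 : C(ComplexSphere n, CStarMatrix (Fin 2) (Fin 2) ℂ)) z) k l :=
      Matrix.sum_apply k l _ _
    rw [hs]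
    simp only [pow_two, ContinuousMap.mul_apply, ContinuousMap.one_apply, CStarMatrix.mul_apply,
      Fin.sum_univ_two, CStarMatrix.one_apply, modelGen, ContinuousMap.coe_mk, modelMatrix_apply]
    fin_cases k <;> fin_cases l <;> simp at h h' ⊢ <;> assumption
  star_eq i := by
    ext z k l
    simp only [ContinuousMap.star_apply, CStarMatrix.star_apply, modelGen, ContinuousMap.coe_mk,
      modelMatrix_apply]
    fin_cases k <;> fin_cases l <;> simp
  half_comm i j k := by
    ext z a b
    simp only [ContinuousMap.mul_apply, CStarMatrix.mul_apply, Fin.sum_univ_two, modelGen,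
      ContinuousMap.coe_mk, modelMatrix_apply]
    fin_cases a <;> fin_cases b <;> simp <;> ring

/-- The matrix model `vᵢ ↦ (0, zᵢ; z̄ᵢ, 0)` of the half-liberated sphere. -/
noncomputable def model (n : ℕ) :
    HalfLiberatedSphere n →⋆ₐ[ℂ] C(ComplexSphere n, CStarMatrix (Fin 2) (Fin 2) ℂ) :=
  lift modelGen relations_modelGen

theorem model_v (i : Fin n) (z : ComplexSphere n) : model n (v i) z = modelMatrix z i :=
  DFunLike.congr_fun (lift_v _ relations_modelGen i) z

theorem continuous_model : Continuous (model n) :=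
  AddMonoidHomClass.continuous_of_bound (model n) 1 (fun x => by
    rw [one_mul]; exact NonUnitalStarAlgHom.norm_apply_le (model n) x)

theorem continuous_entry (k l : Fin 2) :
    Continuous fun M : CStarMatrix (Fin 2) (Fin 2) ℂ => M k l :=
  (continuous_apply l).comp (continuous_apply k)

theorem model_mul_apply (a b : HalfLiberatedSphere n) (z : ComplexSphere n) (k l : Fin 2) :
    model n (a * b) z k l = ∑ j, model n a z k j * model n b z j l := by
  rw [map_mul, ContinuousMap.mul_apply, CStarMatrix.mul_apply]

theorem model_add_apply (a b : HalfLiberatedSphere n) (z : ComplexSphere n) (k l : Fin 2) :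
    model n (a + b) z k l = model n a z k l + model n b z k l := by
  rw [map_add, ContinuousMap.add_apply, CStarMatrix.add_apply]

theorem model_algebraMap_apply (c : ℂ) (z : ComplexSphere n) (k l : Fin 2) :
    model n (algebraMap ℂ _ c) z k l = if k = l then c else 0 := by
  rw [AlgHomClass.commutes (model n) c]
  rfl

/-- Even elements are diagonal in the matrix model. -/
theorem model_apply_of_mem_even {a : HalfLiberatedSphere n} (ha : a ∈ even n)
    (z : ComplexSphere n) {k l : Fin 2} (hkl : k ≠ l) : model n a z k l = 0 := by
  let S : Subalgebra ℂ (HalfLiberatedSphere n) :=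
    { carrier := {a | ∀ k l, k ≠ l → model n a z k l = 0}
      mul_mem' := fun {x y} hx hy k l hkl => by
        rw [model_mul_apply]
        refine Finset.sum_eq_zero fun j _ => ?_
        by_cases hj : k = j
        · rw [hy j l (hj ▸ hkl), mul_zero]
        · rw [hx k j hj, zero_mul]
      add_mem' := fun {x y} hx hy k l hkl => by
        rw [model_add_apply, hx k l hkl, hy k l hkl, add_zero]
      algebraMap_mem' := fun c k l hkl => by
        rw [model_algebraMap_apply, if_neg hkl] }
  have hS : IsClosed (S : Set (HalfLiberatedSphere n)) := by
    have : (S : Set (HalfLiberatedSphere n)) =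
        ⋂ (k) (l) (_ : k ≠ l), {a | model n a z k l = 0} := by
      ext a
      simp only [Set.mem_iInter]
      rfl
    rw [this]
    exact isClosed_iInter fun k => isClosed_iInter fun l => isClosed_iInter fun _ =>
      isClosed_eq ((continuous_entry k l).comp
        ((continuous_eval_const z).comp continuous_model)) continuous_const
  refine mem_of_mem_even S hS (fun i j k l hkl => ?_) ha k l hkl
  simp only [model_mul_apply, Fin.sum_univ_two, model_v, modelMatrix_apply]
  fin_cases k <;> fin_cases l <;> simp at hkl ⊢

/-- Odd elements are off-diagonal in the matrix model. -/
theorem model_apply_of_mem_odd {a : HalfLiberatedSphere n} (ha : a ∈ odd n)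
    (z : ComplexSphere n) (k : Fin 2) : model n a z k k = 0 := by
  -- Each `v i * a` is even, hence diagonal, and an antidiagonal matrix times a diagonal one has
  -- zero diagonal.
  have hs : ∀ (s : Finset (Fin n)), model n (∑ i ∈ s, v i * (v i * a)) z k k = 0 := fun s => by
    induction s using Finset.cons_induction with
    | empty => rw [Finset.sum_empty, map_zero]; rfl
    | cons i s hi ih =>
      have h := fun k l hkl => model_apply_of_mem_even (v_mul_mem_even ha i) z (k := k) (l := l) hkl
      rw [Finset.sum_cons, model_add_apply, ih, add_zero, model_mul_apply, Fin.sum_univ_two,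
        model_v, modelMatrix_apply, modelMatrix_apply]
      fin_cases k <;> simp [h, -map_mul]
  rw [← sum_v_mul_v_mul a]
  exact hs _

/-- The character of the even part given by a diagonal entry of the matrix model at `z`. -/
noncomputable def evenChar (z : ComplexSphere n) (k : Fin 2) : even n →⋆ₐ[ℂ] ℂ where
  toFun a := model n a z k k
  map_one' := by
    rw [OneMemClass.coe_one, ← map_one (algebraMap ℂ (HalfLiberatedSphere n)),
      model_algebraMap_apply, if_pos rfl]
  map_mul' a b := by
    rw [MulMemClass.coe_mul, model_mul_apply]
    refine Finset.sum_eq_single k (fun j _ hj => ?_) (fun h => absurd (Finset.mem_univ k) h)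
    rw [model_apply_of_mem_even a.2 z hj.symm, zero_mul]
  map_zero' := by
    rw [ZeroMemClass.coe_zero, map_zero]
    rfl
  map_add' a b := model_add_apply _ _ z k k
  commutes' c := (model_algebraMap_apply c z k k).trans (if_pos rfl)
  map_star' a := by
    rw [StarMemClass.coe_star, map_star]
    rfl

theorem evenChar_apply (z : ComplexSphere n) (k : Fin 2) (a : even n) :
    evenChar z k a = model n a z k k := rfl

theorem evenChar_zero_vv (z : ComplexSphere n) (i j : Fin n) :
    evenChar z 0 (vv i j) = z.1 i * star (z.1 j) := by
  rw [evenChar_apply]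
  refine (model_mul_apply (v i) (v j) z _ _).trans ?_
  simp [Fin.sum_univ_two, model_v, modelMatrix_apply]

theorem evenChar_one_vv (z : ComplexSphere n) (i j : Fin n) :
    evenChar z 1 (vv i j) = star (z.1 i) * z.1 j := by
  rw [evenChar_apply]
  refine (model_mul_apply (v i) (v j) z _ _).trans ?_
  simp [Fin.sum_univ_two, model_v, modelMatrix_apply]

theorem evenChar_eq_of_coordFun_eq {z w : ComplexSphere n}
    (h : ∀ i j, z.1 i * star (z.1 j) = w.1 i * star (w.1 j)) : evenChar z 0 = evenChar w 0 :=
  even_hom_ext fun i j => by rw [evenChar_zero_vv, evenChar_zero_vv, h]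

/-- This is where complex conjugation enters: the two diagonal entries of the model are conjugate
evaluations. -/
theorem evenChar_one (z : ComplexSphere n) : evenChar z 1 = evenChar (sphereConj z) 0 :=
  even_hom_ext fun i j => by
    rw [evenChar_zero_vv, evenChar_one_vv]
    change _ = star (z.1 i) * star (star (z.1 j))
    rw [star_star]

/-- A hermitian matrix of trace one whose `2 × 2` minors vanish is the projection onto the line
spanned by a unit vector. -/
theorem exists_eq_mul_star (p : Fin n → Fin n → ℂ) (hmul : ∀ i j k l, p i j * p k l = p k j * p i l)
    (hstar : ∀ i j, star (p i j) = p j i) (hsum : ∑ i, p i i = 1) :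
    ∃ z : ComplexSphere n, ∀ i j, p i j = z.1 i * star (z.1 j) := by
  -- Multiply by the trace: pᵢᵢpₖₖ = pₖᵢpᵢₖ = |pᵢₖ|². In particular the diagonal is nonnegative.
  have hpos : ∀ i, p i i = ((∑ k, ‖p i k‖ ^ 2 : ℝ) : ℂ) := fun i => by
    rw [← mul_one (p i i), ← hsum, Finset.mul_sum, Complex.ofReal_sum]
    refine Finset.sum_congr rfl fun k _ => ?_
    rw [hmul, mul_comm, ← hstar i k, Complex.star_def, Complex.mul_conj, Complex.normSq_eq_norm_sq]
  have hk : ∃ k, p k k ≠ 0 := by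
    by_contra! h
    rw [Finset.sum_eq_zero fun i _ => h i] at hsum
    exact zero_ne_one hsum
  obtain ⟨k, hk⟩ := hk
  obtain ⟨r, hr, hrk⟩ : ∃ r : ℝ, r ≠ 0 ∧ p k k = (r : ℂ) * r := by
    refine ⟨Real.sqrt (∑ j, ‖p k j‖ ^ 2), ?_, ?_⟩
    · intro h0
      rw [Real.sqrt_eq_zero (by positivity)] at h0
      exact hk (by rw [hpos, h0, Complex.ofReal_zero])
    · rw [← Complex.ofReal_mul, Real.mul_self_sqrt (by positivity)]
      exact hpos k
  have hr' : (r : ℂ) ≠ 0 := by exact_mod_cast hr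
  -- The vector is the `k`-th column divided by r = √pₖₖ; the identity is pᵢₖpₖⱼ = pₖₖpᵢⱼ.
  have key : ∀ i j, p i k / r * star (p j k / r) = p i j := fun i j => by
    have hsr : star (r : ℂ) = r := Complex.conj_ofReal r
    rw [star_div₀, hstar, hsr, div_mul_div_comm, hmul, hrk]
    field_simp
  have hz : (WithLp.toLp 2 fun i => p i k / r : EuclideanSpace ℂ (Fin n)) ∈
      Metric.sphere (0 : EuclideanSpace ℂ (Fin n)) 1 := by
    rw [mem_sphere_zero_iff_norm, EuclideanSpace.norm_eq, Real.sqrt_eq_one]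
    have h : ∑ i, p i k / r * star (p i k / r) = 1 := by rw [← hsum]; simp_rw [key]
    simp_rw [Complex.star_def, Complex.mul_conj, Complex.normSq_eq_norm_sq] at h
    exact_mod_cast h
  exact ⟨⟨_, hz⟩, fun i j => (key i j).symm⟩

/-- Every character of the even part is an evaluation on the complex sphere. -/
theorem exists_evenChar_eq (χ : even n →⋆ₐ[ℂ] ℂ) : ∃ z : ComplexSphere n, χ = evenChar z 0 := by
  obtain ⟨z, hz⟩ := exists_eq_mul_star (fun i j => χ (vv i j))
    (fun i j k l => by
      rw [← map_mul, ← map_mul]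
      exact congrArg χ (Subtype.ext (v_mul_v_mul_v_mul_v i j k l)))
    (fun i j => by
      rw [← map_star]
      refine congrArg χ (Subtype.ext ?_)
      change star (v i * v j) = v j * v i
      rw [star_mul, relations.star_eq, relations.star_eq])
    (by
      rw [← map_sum, ← map_one χ]
      refine congrArg χ (Subtype.ext ?_)
      rw [AddSubmonoidClass.coe_finsetSum]
      exact (Finset.sum_congr rfl fun i _ => (pow_two _).symm).trans relations.sum_sq)
  exact ⟨z, even_hom_ext fun i j => by rw [evenChar_zero_vv, hz]⟩

end HalfLiberatedSphere

/-! ### The functions zᵢz̄ⱼ separate the points of projective space -/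

namespace ComplexProjectiveSpace

variable {n : ℕ}

theorem mk_eq_mk_of_coordFun_eq {z w : ComplexSphere n}
    (h : ∀ i j, z.1 i * star (z.1 j) = w.1 i * star (w.1 j)) :
    (Quotient.mk'' z : ComplexProjectiveSpace n) = Quotient.mk'' w := by
  obtain ⟨k, hk⟩ : ∃ k, z.1 k ≠ 0 := by
    by_contra! h0
    have := HalfLiberatedSphere.sum_mul_star_eq_one z
    rw [Finset.sum_eq_zero fun i _ => by rw [h0 i, zero_mul]] at this
    exact zero_ne_one this
  have hk' : star (z.1 k) ≠ 0 := star_ne_zero.mpr hk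
  have hnorm : ‖w.1 k‖ = ‖z.1 k‖ := by
    have := congrArg norm (h k k)
    rw [norm_mul, norm_mul, norm_star, norm_star] at this
    exact ((mul_self_inj (norm_nonneg _) (norm_nonneg _)).mp this).symm
  -- The phase is forced: wᵢw̄ₖ = zᵢz̄ₖ gives zᵢ = (w̄ₖ/z̄ₖ)wᵢ.
  refine Quotient.sound' ⟨⟨star (w.1 k) / star (z.1 k), ?_⟩, ?_⟩
  · rw [mem_sphere_zero_iff_norm, norm_div, norm_star, norm_star, hnorm,
      div_self (norm_ne_zero_iff.mpr hk)]
  · apply Subtype.ext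
    ext i
    change star (w.1 k) / star (z.1 k) * w.1 i = z.1 i
    rw [div_mul_eq_mul_div, mul_comm, ← h, mul_div_cancel_right₀ _ hk']

theorem eq_of_coordFun_eq {x y : ComplexProjectiveSpace n}
    (h : ∀ i j, coordFun i j x = coordFun i j y) : x = y := by
  induction x using Quotient.inductionOn'
  induction y using Quotient.inductionOn'
  exact mk_eq_mk_of_coordFun_eq h

theorem t2Space : T2Space (ComplexProjectiveSpace n) :=
  T2Space.of_injective_continuous
    (f := fun x => fun i j => (coordFun i j : C(ComplexProjectiveSpace n, ℂ)) x)
    (fun _ _ h => eq_of_coordFun_eq fun i j => congrFun (congrFun h i) j)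
    (continuous_pi fun i => continuous_pi fun j => (coordFun i j).continuous)

theorem compactSpace : CompactSpace (ComplexProjectiveSpace n) := Quotient.compactSpace

theorem conj_mk (z : ComplexSphere n) :
    conj (Quotient.mk'' z : ComplexProjectiveSpace n) = Quotient.mk'' (sphereConj z) := rfl

end ComplexProjectiveSpace

/-! ### The isomorphism between functions on projective space and the even part -/

namespace HalfLiberatedSphere

open ComplexProjectiveSpace

attribute [local instance] isClosed_even t2Space compactSpace

variable {n : ℕ}

theorem evenChar_eq_of_mk_eq {z w : ComplexSphere n}
    (h : (Quotient.mk'' z : ComplexProjectiveSpace n) = Quotient.mk'' w) :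
    evenChar z 0 = evenChar w 0 :=
  evenChar_eq_of_coordFun_eq fun i j => congrArg (coordFun i j) h

/-- The `*`-homomorphism from the even part to the functions on the projective space given by
the upper left entry of the matrix model. -/
noncomputable def evenToProjective (n : ℕ) : even n →⋆ₐ[ℂ] C(ComplexProjectiveSpace n, ℂ) where
  toFun a :=
    { toFun := Quotient.lift (fun z : ComplexSphere n => evenChar z 0 a)
        fun _ _ h => DFunLike.congr_fun (evenChar_eq_of_mk_eq (Quotient.sound' h)) a
      continuous_toFun := Continuous.quotient_lift
        ((continuous_entry 0 0).comp (model n a).continuous) _ }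
  map_one' := by
    ext x
    induction x using Quotient.inductionOn' with | h z => exact map_one (evenChar z 0)
  map_mul' a b := by
    ext x
    induction x using Quotient.inductionOn' with | h z => exact map_mul (evenChar z 0) a b
  map_zero' := by
    ext x
    induction x using Quotient.inductionOn' with | h z => exact map_zero (evenChar z 0)
  map_add' a b := by
    ext x
    induction x using Quotient.inductionOn' with | h z => exact map_add (evenChar z 0) a b
  commutes' c := by
    ext x
    induction x using Quotient.inductionOn' with
    | h z => exact AlgHomClass.commutes (evenChar z 0) c
  map_star' a := by
    ext x
    induction x using Quotient.inductionOn' with | h z => exact map_star (evenChar z 0) a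

theorem evenToProjective_mk (a : even n) (z : ComplexSphere n) :
    evenToProjective n a (Quotient.mk'' z) = evenChar z 0 a := rfl

theorem evenToProjective_vv (i j : Fin n) : evenToProjective n (vv i j) = coordFun i j := by
  ext x
  induction x using Quotient.inductionOn' with | h z => exact evenChar_zero_vv z i j

/-- By Gelfand duality characters separate the even part, and each of them is evaluation at a point
of the sphere. -/
theorem evenToProjective_injective : Function.Injective (evenToProjective n) := by
  let := evenCommCStarAlgebra n
  refine (injective_iff_map_eq_zero _).mpr fun a ha => ?_
  refine (map_eq_zero_iff _ (gelfandTransform_bijective (even n)).injective).mp ?_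
  ext χ
  obtain ⟨z, hz⟩ := exists_evenChar_eq (χ : even n →⋆ₐ[ℂ] ℂ)
  have h : χ a = evenChar z 0 a := DFunLike.congr_fun hz a
  exact h.trans (DFunLike.congr_fun ha (Quotient.mk'' z))

/-- An injective `*`-homomorphism of C⋆-algebras is isometric, so its range is closed; it is dense
by Stone–Weierstrass. -/
theorem evenToProjective_bijective : Function.Bijective (evenToProjective n) := by
  refine ⟨evenToProjective_injective, ?_⟩
  have hiso : Isometry (evenToProjective n) :=
    NonUnitalStarAlgHom.isometry _ evenToProjective_injective
  have hclosed : IsClosed ((evenToProjective n).range : Set C(ComplexProjectiveSpace n, ℂ)) := by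
    change IsClosed (Set.range (evenToProjective n))
    exact hiso.isClosedEmbedding.isClosed_range
  have htop := ContinuousMap.starSubalgebra_topologicalClosure_eq_top_of_separatesPoints
    (evenToProjective n).range (by
      intro x y hxy
      by_contra! h
      refine hxy (eq_of_coordFun_eq fun i j => ?_)
      exact h _ ⟨coordFun i j, ⟨vv i j, evenToProjective_vv i j⟩, rfl⟩)
  intro f
  have hf : f ∈ (evenToProjective n).range.topologicalClosure := htop ▸ StarSubalgebra.mem_top
  rwa [← SetLike.mem_coe, StarSubalgebra.topologicalClosure_coe, hclosed.closure_eq] at hf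

/-- The isomorphism `zᵢ zⱼ^* ↦ vᵢ vⱼ`. -/
noncomputable def projectiveEquivEven (n : ℕ) : C(ComplexProjectiveSpace n, ℂ) ≃⋆ₐ[ℂ] even n :=
  (StarAlgEquiv.ofBijective (evenToProjective n) evenToProjective_bijective).symm

theorem projectiveEquivEven_evenToProjective (a : even n) :
    projectiveEquivEven n (evenToProjective n a) = a :=
  (StarAlgEquiv.ofBijective (evenToProjective n) evenToProjective_bijective).symm_apply_apply a

theorem evenToProjective_projectiveEquivEven (f : C(ComplexProjectiveSpace n, ℂ)) :
    evenToProjective n (projectiveEquivEven n f) = f :=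
  (StarAlgEquiv.ofBijective (evenToProjective n) evenToProjective_bijective).apply_symm_apply f

theorem projectiveEquivEven_coordFun (i j : Fin n) :
    (projectiveEquivEven n (coordFun i j) : HalfLiberatedSphere n) = v i * v j := by
  rw [← evenToProjective_vv, projectiveEquivEven_evenToProjective]
  rfl

/-- Composing `Φ` with `evenToProjective` fixes every `vv i j`, hence is the identity of the even
part. -/
theorem eq_projectiveEquivEven (Φ : C(ComplexProjectiveSpace n, ℂ) ≃⋆ₐ[ℂ] even n)
    (hΦ : ∀ i j : Fin n, (Φ (coordFun i j) : HalfLiberatedSphere n) = v i * v j) :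
    Φ = projectiveEquivEven n := by
  have h : (Φ : C(ComplexProjectiveSpace n, ℂ) →⋆ₐ[ℂ] even n).comp (evenToProjective n) =
      StarAlgHom.id ℂ (even n) := even_hom_ext fun i j => by
    refine Subtype.ext ((congrArg (fun f => (Φ f : HalfLiberatedSphere n))
      (evenToProjective_vv i j)).trans (hΦ i j))
  refine StarAlgEquiv.ext fun f => ?_
  have h' := DFunLike.congr_fun h (projectiveEquivEven n f)
  rw [StarAlgHom.comp_apply, evenToProjective_projectiveEquivEven] at h'
  exact h'

/-! ### Ideals -/

/-- A graded two-sided ideal is generated by its even elements. -/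
theorem span_even_eq (I : TwoSidedIdeal (HalfLiberatedSphere n))
    (hI : ∀ a ∈ I, ∃ b ∈ I, ∃ c ∈ I, b ∈ even n ∧ c ∈ odd n ∧ a = b + c) :
    TwoSidedIdeal.span {a | a ∈ I ∧ a ∈ even n} = I := by
  refine le_antisymm (TwoSidedIdeal.span_le.mpr fun a ha => ha.1) fun a ha => ?_
  obtain ⟨b, hb, c, hc, hbe, hco, rfl⟩ := hI a ha
  refine TwoSidedIdeal.add_mem _ (TwoSidedIdeal.subset_span ⟨hb, hbe⟩) ?_
  rw [← sum_v_mul_v_mul c]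
  exact sum_mem fun i _ => TwoSidedIdeal.mul_mem_left _ _ _
    (TwoSidedIdeal.subset_span ⟨I.mul_mem_left _ _ hc, v_mul_mem_even hco i⟩)

theorem isSymmetric_of_exists (X : QuantumSubspace (HalfLiberatedSphere n))
    (h : ∀ a ∈ X.ideal, ∃ b ∈ X.ideal, ∃ c ∈ X.ideal, b ∈ even n ∧ c ∈ odd n ∧ a = b + c) :
    IsSymmetric X := by
  intro a ha
  obtain ⟨b, hb, c, hc, hbe, hco, rfl⟩ := h a ha
  refine ⟨(b, c), ⟨⟨hb, hbe⟩, ⟨hc, hco⟩, rfl⟩, ?_⟩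
  rintro ⟨b', c'⟩ ⟨⟨-, hbe'⟩, ⟨-, hco'⟩, h⟩
  have h1 : b - b' = c' - c := by rw [sub_eq_sub_iff_add_eq_add, h, add_comm]
  have h2 : b - b' = 0 := eq_zero_of_mem_even_of_mem_odd (sub_mem hbe hbe')
    (h1 ▸ sub_mem hco' hco)
  exact Prod.ext (sub_eq_zero.mp h2).symm (sub_eq_zero.mp (h1 ▸ h2))

theorem IsSymmetric.exists_even_odd {X : QuantumSubspace (HalfLiberatedSphere n)}
    (hX : IsSymmetric X) (a : HalfLiberatedSphere n) (ha : a ∈ X.ideal) :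
    ∃ b ∈ X.ideal, ∃ c ∈ X.ideal, b ∈ even n ∧ c ∈ odd n ∧ a = b + c := by
  obtain ⟨⟨b, c⟩, ⟨⟨hb, hbe⟩, ⟨hc, hco⟩, h⟩, -⟩ := hX a ha
  exact ⟨b, hb, c, hc, hbe, hco, h⟩

/-- The ideal of elements whose matrix model vanishes on the cone over `Y`. -/
noncomputable def modelIdeal (Y : Set (ComplexProjectiveSpace n)) :
    TwoSidedIdeal (HalfLiberatedSphere n) :=
  TwoSidedIdeal.mk' {a | ∀ z : ComplexSphere n, Quotient.mk'' z ∈ Y → ∀ k l, model n a z k l = 0}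
    (fun z _ k l => by rw [map_zero]; rfl)
    (fun {x y} hx hy z hz k l => by rw [model_add_apply, hx z hz, hy z hz, add_zero])
    (fun {x} hx z hz k l => by
      rw [map_neg]
      exact neg_eq_zero.mpr (hx z hz k l))
    (fun {x y} hy z hz k l => by
      rw [model_mul_apply]
      exact Finset.sum_eq_zero fun j _ => by rw [hy z hz, mul_zero])
    (fun {x y} hx z hz k l => by
      rw [model_mul_apply]
      exact Finset.sum_eq_zero fun j _ => by rw [hx z hz, zero_mul])

theorem mem_modelIdeal {Y : Set (ComplexProjectiveSpace n)} {a : HalfLiberatedSphere n} :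
    a ∈ modelIdeal Y ↔
      ∀ z : ComplexSphere n, Quotient.mk'' z ∈ Y → ∀ k l, model n a z k l = 0 :=
  TwoSidedIdeal.mem_mk' _ _ _ _ _ _ _

theorem isClosed_modelIdeal (Y : Set (ComplexProjectiveSpace n)) :
    IsClosed (modelIdeal Y : Set (HalfLiberatedSphere n)) := by
  have : (modelIdeal Y : Set (HalfLiberatedSphere n)) =
      ⋂ (z : ComplexSphere n) (_ : Quotient.mk'' z ∈ Y) (k) (l), {a | model n a z k l = 0} := by
    ext a
    simp only [Set.mem_iInter, SetLike.mem_coe, mem_modelIdeal]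
    rfl
  rw [this]
  exact isClosed_iInter fun z => isClosed_iInter fun _ => isClosed_iInter fun k =>
    isClosed_iInter fun l => isClosed_eq ((continuous_entry k l).comp
      ((continuous_eval_const z).comp continuous_model)) continuous_const

theorem exists_even_odd_of_mem_modelIdeal (Y : Set (ComplexProjectiveSpace n))
    (a : HalfLiberatedSphere n) (ha : a ∈ modelIdeal Y) :
    ∃ b ∈ modelIdeal Y, ∃ c ∈ modelIdeal Y, b ∈ even n ∧ c ∈ odd n ∧ a = b + c := by
  obtain ⟨b, hb, c, hc, rfl⟩ := exists_even_add_odd a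
  rw [mem_modelIdeal] at ha
  refine ⟨b, mem_modelIdeal.mpr fun z hz k l => ?_, c, mem_modelIdeal.mpr fun z hz k l => ?_,
    hb, hc, rfl⟩
  · by_cases hkl : k = l
    · subst hkl
      have h := ha z hz k k
      rwa [model_add_apply, model_apply_of_mem_odd hc, add_zero] at h
    · exact model_apply_of_mem_even hb z hkl
  · by_cases hkl : k = l
    · subst hkl
      exact model_apply_of_mem_odd hc z k
    · have h := ha z hz k l
      rwa [model_add_apply, model_apply_of_mem_even hb z hkl, zero_add] at h

/-- The function records only the upper left entry; stability of `Y` under conjugation supplies the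
vanishing of the lower right one. -/
theorem mem_modelIdeal_iff {Y : Set (ComplexProjectiveSpace n)} (hY : ∀ y ∈ Y, conj y ∈ Y)
    (a : even n) :
    (a : HalfLiberatedSphere n) ∈ modelIdeal Y ↔ evenToProjective n a ∈ vanishing Y := by
  rw [mem_modelIdeal]
  refine ⟨fun h y hy => ?_, fun h z hz k l => ?_⟩
  · induction y using Quotient.inductionOn' with | h z => exact h z hy 0 0
  · by_cases hkl : k = l
    · subst hkl
      have h0 := h _ hz
      have h1 := h _ (hY _ hz)
      rw [conj_mk, evenToProjective_mk, ← evenChar_one] at h1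
      fin_cases k
      · exact h0
      · exact h1
    · exact model_apply_of_mem_even a.2 z hkl

theorem image_vanishing {Y : Set (ComplexProjectiveSpace n)} (hY : ∀ y ∈ Y, conj y ∈ Y) :
    (fun f => (projectiveEquivEven n f : HalfLiberatedSphere n)) '' vanishing Y =
      {a | a ∈ modelIdeal Y ∧ a ∈ even n} := by
  ext a
  constructor
  · rintro ⟨f, hf, rfl⟩
    refine ⟨(mem_modelIdeal_iff hY _).mpr ?_, (projectiveEquivEven n f).2⟩
    rwa [evenToProjective_projectiveEquivEven]
  · rintro ⟨ha, hae⟩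
    exact ⟨evenToProjective n ⟨a, hae⟩, (mem_modelIdeal_iff hY ⟨a, hae⟩).mp ha,
      congrArg Subtype.val (projectiveEquivEven_evenToProjective ⟨a, hae⟩)⟩

/-- Since `modelIdeal Y` is closed, the algebraically generated ideal needs no closure. -/
theorem modelIdeal_eq_span {Y : Set (ComplexProjectiveSpace n)} (hY : ∀ y ∈ Y, conj y ∈ Y) :
    modelIdeal Y = TwoSidedIdeal.span
      ((fun f => (projectiveEquivEven n f : HalfLiberatedSphere n)) '' vanishing Y) := by
  rw [image_vanishing hY, span_even_eq _ (exists_even_odd_of_mem_modelIdeal Y)]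

/-- The symmetric quantum subspace defined by a conjugation-stable closed subspace. -/
noncomputable def symmetricSubspace (Y : ConjStableClosed n) :
    {X : QuantumSubspace (HalfLiberatedSphere n) // IsSymmetric X} :=
  ⟨⟨modelIdeal Y.1, isClosed_modelIdeal _⟩,
    isSymmetric_of_exists _ (exists_even_odd_of_mem_modelIdeal _)⟩

/-! ### Bijectivity: recovering the subspace from the even part of the ideal -/

theorem vanishing_eq_idealOfSet (Y : Set (ComplexProjectiveSpace n)) :
    vanishing Y = ContinuousMap.idealOfSet ℂ Yᶜ := by
  ext f
  rw [SetLike.mem_coe, ContinuousMap.mem_idealOfSet, compl_compl]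
  rfl

theorem symmetricSubspace_injective : Function.Injective (symmetricSubspace (n := n)) := by
  intro Y Y' h
  have hI : modelIdeal (Y.1 : Set (ComplexProjectiveSpace n)) = modelIdeal Y'.1 :=
    congrArg (fun X => X.1.ideal) h
  have hV : vanishing (Y.1 : Set (ComplexProjectiveSpace n)) = vanishing Y'.1 := by
    ext f
    rw [← evenToProjective_projectiveEquivEven f, ← mem_modelIdeal_iff Y.2,
      ← mem_modelIdeal_iff Y'.2, hI]
  rw [vanishing_eq_idealOfSet, vanishing_eq_idealOfSet, SetLike.coe_set_eq] at hV
  have hS := congrArg ContinuousMap.setOfIdeal hV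
  rw [ContinuousMap.setOfIdeal_ofSet_of_isOpen ℂ Y.1.isClosed.isOpen_compl,
    ContinuousMap.setOfIdeal_ofSet_of_isOpen ℂ Y'.1.isClosed.isOpen_compl] at hS
  exact Subtype.ext (SetLike.coe_injective (compl_injective hS))

/-- The element `∑ vₖ a vₖ`, for `a` in the even part. -/
noncomputable def evenConj (a : even n) : even n :=
  ⟨∑ k, v k * (a : HalfLiberatedSphere n) * v k, sum_mem fun k _ => v_mul_mul_v_mem_even a.2 k k⟩

/-- The upper left entry of vₖavₖ is |zₖ|² times the lower right entry of a, and the weights sum to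
one. This forces the zero set of an ideal to be conjugation-stable. -/
theorem evenToProjective_evenConj (a : even n) (x : ComplexProjectiveSpace n) :
    evenToProjective n (evenConj a) x = evenToProjective n a (conj x) := by
  induction x using Quotient.inductionOn' with | h z =>
  have hs : ∀ s : Finset (Fin n), model n (∑ k ∈ s, v k * (a : HalfLiberatedSphere n) * v k) z 0 0 =
      (∑ k ∈ s, z.1 k * star (z.1 k)) * model n a z 1 1 := fun s => by
    induction s using Finset.cons_induction with
    | empty => rw [Finset.sum_empty, Finset.sum_empty, zero_mul, map_zero]; rfl
    | cons i s hi ih =>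
      rw [Finset.sum_cons, Finset.sum_cons, model_add_apply, ih, add_mul]
      congr 1
      simp only [model_mul_apply, Fin.sum_univ_two, model_v, modelMatrix_apply]
      simp
      ring
  have h := hs Finset.univ
  rw [sum_mul_star_eq_one, one_mul] at h
  rw [conj_mk, evenToProjective_mk, evenToProjective_mk, ← evenChar_one]
  exact h

/-- The functions on the projective space that correspond to the even elements of an ideal. -/
noncomputable def functionIdeal (I : TwoSidedIdeal (HalfLiberatedSphere n)) :
    Ideal C(ComplexProjectiveSpace n, ℂ) where
  carrier := {f | (projectiveEquivEven n f : HalfLiberatedSphere n) ∈ I}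
  zero_mem' := by
    change (projectiveEquivEven n 0 : HalfLiberatedSphere n) ∈ I
    rw [map_zero]
    exact I.zero_mem
  add_mem' {f g} hf hg := by
    change (projectiveEquivEven n (f + g) : HalfLiberatedSphere n) ∈ I
    rw [map_add]
    exact I.add_mem hf hg
  smul_mem' c f hf := by
    change (projectiveEquivEven n (c * f) : HalfLiberatedSphere n) ∈ I
    rw [map_mul]
    exact I.mul_mem_left _ _ hf

theorem mem_functionIdeal {I : TwoSidedIdeal (HalfLiberatedSphere n)}
    {f : C(ComplexProjectiveSpace n, ℂ)} :
    f ∈ functionIdeal I ↔ (projectiveEquivEven n f : HalfLiberatedSphere n) ∈ I := Iff.rfl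

theorem evenToProjective_mem_functionIdeal {I : TwoSidedIdeal (HalfLiberatedSphere n)}
    (a : even n) : evenToProjective n a ∈ functionIdeal I ↔ (a : HalfLiberatedSphere n) ∈ I := by
  rw [mem_functionIdeal, projectiveEquivEven_evenToProjective]

theorem isClosed_functionIdeal {I : TwoSidedIdeal (HalfLiberatedSphere n)}
    (hI : IsClosed (I : Set (HalfLiberatedSphere n))) :
    IsClosed (functionIdeal I : Set C(ComplexProjectiveSpace n, ℂ)) := by
  have hc : Continuous (projectiveEquivEven n) :=
    AddMonoidHomClass.continuous_of_bound (projectiveEquivEven n) 1 (fun x => by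
      rw [one_mul]; exact NonUnitalStarAlgHom.norm_apply_le (projectiveEquivEven n) x)
  exact hI.preimage (continuous_subtype_val.comp hc)

theorem symmetricSubspace_surjective : Function.Surjective (symmetricSubspace (n := n)) := by
  rintro ⟨X, hX⟩
  set J := functionIdeal X.ideal with hJ
  -- `Y` is the common zero set of the functions in `J`.
  let Y : TopologicalSpace.Closeds (ComplexProjectiveSpace n) :=
    ⟨(ContinuousMap.setOfIdeal J)ᶜ, (ContinuousMap.setOfIdeal_open J).isClosed_compl⟩
  have hY : ∀ y ∈ Y, conj y ∈ Y := by
    intro y hy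
    refine ContinuousMap.notMem_setOfIdeal.mpr fun f hf => ?_
    rw [← evenToProjective_projectiveEquivEven f, ← evenToProjective_evenConj]
    refine ContinuousMap.notMem_setOfIdeal.mp hy
      ((evenToProjective_mem_functionIdeal _).mpr ?_)
    change ∑ k, v k * (projectiveEquivEven n f : HalfLiberatedSphere n) * v k ∈ X.ideal
    exact sum_mem fun k _ => X.ideal.mul_mem_right _ _ (X.ideal.mul_mem_left _ _ hf)
  -- On a compact Hausdorff space a closed ideal consists of all functions vanishing on its zero
  -- set.
  have hV : vanishing (Y : Set (ComplexProjectiveSpace n)) = J := by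
    rw [vanishing_eq_idealOfSet]
    change (ContinuousMap.idealOfSet ℂ (ContinuousMap.setOfIdeal J)ᶜᶜ :
      Set C(ComplexProjectiveSpace n, ℂ)) = J
    rw [compl_compl, ContinuousMap.idealOfSet_ofIdeal_isClosed (isClosed_functionIdeal X.isClosed)]
  refine ⟨⟨Y, hY⟩, Subtype.ext (QuantumSubspace.ext ?_)⟩
  change modelIdeal (Y : Set (ComplexProjectiveSpace n)) = X.ideal
  -- Both ideals are graded, so comparing their even elements suffices.
  rw [← span_even_eq _ (exists_even_odd_of_mem_modelIdeal _),
    ← span_even_eq X.ideal hX.exists_even_odd]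
  congr 1
  ext a
  refine and_congr_left fun ha => ?_
  rw [mem_modelIdeal_iff hY ⟨a, ha⟩, hV]
  exact evenToProjective_mem_functionIdeal ⟨a, ha⟩

end HalfLiberatedSphere

theorem mainTheorem2 (n : ℕ) (hn : 1 ≤ n) :
    (∃! Φ : C(ComplexProjectiveSpace n, ℂ) ≃⋆ₐ[ℂ] HalfLiberatedSphere.even n,
      ∀ i j : Fin n, (Φ (ComplexProjectiveSpace.coordFun i j) : HalfLiberatedSphere n) =
        HalfLiberatedSphere.v i * HalfLiberatedSphere.v j) ∧
    ∀ Φ : C(ComplexProjectiveSpace n, ℂ) ≃⋆ₐ[ℂ] HalfLiberatedSphere.even n,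
      (∀ i j : Fin n, (Φ (ComplexProjectiveSpace.coordFun i j) : HalfLiberatedSphere n) =
        HalfLiberatedSphere.v i * HalfLiberatedSphere.v j) →
      ∃ X : ComplexProjectiveSpace.ConjStableClosed n →
          {X : QuantumSubspace (HalfLiberatedSphere n) // HalfLiberatedSphere.IsSymmetric X},
        Function.Bijective X ∧
        ∀ Y : ComplexProjectiveSpace.ConjStableClosed n,
          (X Y).1.ideal = TwoSidedIdeal.span
            ((fun f => (Φ f : HalfLiberatedSphere n)) ''
              ComplexProjectiveSpace.vanishing (Y.1 : Set (ComplexProjectiveSpace n))) := by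
  refine ⟨⟨HalfLiberatedSphere.projectiveEquivEven n,
    HalfLiberatedSphere.projectiveEquivEven_coordFun, HalfLiberatedSphere.eq_projectiveEquivEven⟩,
    fun Φ hΦ => ?_⟩
  obtain rfl := HalfLiberatedSphere.eq_projectiveEquivEven Φ hΦ
  exact ⟨HalfLiberatedSphere.symmetricSubspace,
    ⟨HalfLiberatedSphere.symmetricSubspace_injective,
      HalfLiberatedSphere.symmetricSubspace_surjective⟩,
    fun Y => HalfLiberatedSphere.modelIdeal_eq_span Y.2⟩
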